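/- Let $T$ be a caterpillar with at least two vertices, i.e. a finite tree such that deleting all its pendant vertices (vertices of degree $1$) leaves a path (possibly with no vertices). For $R\subseteq V(T)$ let $R_0=R$ and let $R_{t+1}$ be $R_t$ together with all vertices having at least two neighbours in $R_t$. A set $S$ is $P_3$-convex if every vertex outside $S$ has at most one neighbour in $S$; $R$ is a hull set if the smallest $P_3$-convex set containing $R$ is $V(T)$; in that case $\tau_R(T)$ is the least $t$ with $R_t=V(T)$. The percolation time is $\tau(T)=\max\{\tau_R(T): R \text{ a hull set of } T\}$. $T$ has a dominating path whose two endpoints are distinct leaves (every vertex not on the path has a neighbour on it). Let $v_1,\dots,v_k$ be any such path and put $d_i=\min\{\deg_T(v_i),4\}$. Define $\ell(1)=1$ and, for $i\ge 2$, $\ell(i)=\ell(i-1)$ if $d_i=d_{i-1}=3$, and $\ell(i)=\ell(i-1)+1$ otherwise. Let $n(i)$ and $m(i)$ be the least and the greatest $j\in\{1,\dots,k\}$ with $\ell(j)=\ell(i)$. Define $f_1,\dots,f_k$ as follows. - If $d_i=1$, then $f_i=0$. If $d_i=4$, then $f_i=1$. - If $d_i=3$, let $x=i-n(i)$, $y=m(i)-i$,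 $a=d_{n(i)-1}$, $b=d_{m(i)+1}$. Then $$f_i=\begin{cases}\min\{x,y\}+1&(a,b)=(1,1)\\ \max\{x,y\}+1&(a,b)=(2,2)\\ x+1&(a,b)=(1,2)\\ y+1&(a,b)=(2,1)\\ \min\{x+1,y+2\}&(a,b)=(1,4)\\ \min\{x+2,y+1\}&(a,b)=(4,1)\\ x+2&(a,b)=(4,2)\\ y+2&(a,b)=(2,4)\\ \min\{x,y\}+2&(a,b)=(4,4).\end{cases}$$ - If $d_i=2$, then $f_i=1$ if $d_{i-1},d_{i+1}\in\{1,2\}$; $f_i=f_{i+1}+1$ if $d_{i-1}\in\{1,2\}$ and $d_{i+1}\notin\{1,2\}$; $f_i=f_{i-1}+1$ if $d_{i-1}\notin\{1,2\}$ and $d_{i+1}\in\{1,2\}$; $f_i=\max\{f_{i-1},f_{i+1}\}+1$ if $d_{i-1},d_{i+1}\notin\{1,2\}$. Then, with $F(T)=\max_{1\le i\le k}f_i$, we have $\tau(T)=F(T)$. -/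

import Mathlib

/-- A caterpillar: a tree such that the removal of all its pendant vertices yields a path
(possibly the path with no vertices, as happens for the tree with a single edge). -/
def IsCaterpillar {V : Type*} [Fintype V] (G : SimpleGraph V) [DecidableRel G.Adj] : Prop :=
  G.IsTree ∧
    ∃ n : ℕ, Nonempty (G.induce {v : V | G.degree v ≠ 1} ≃g SimpleGraph.pathGraph n)

/-- `S` is convex in the convexity generated by the paths of length two. -/
def IsP3Convex {V : Type*} (G : SimpleGraph V) (S : Set V) : Prop :=
  ∀ u v w : V, u ≠ w → G.Adj u v → G.Adj v w → u ∈ S → w ∈ S → v ∈ S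

/-- The smallest convex set containing `R`. -/
def p3Hull {V : Type*} (G : SimpleGraph V) (R : Set V) : Set V :=
  ⋂₀ {S : Set V | IsP3Convex G S ∧ R ⊆ S}

/-- `R` percolates `G`, i.e. `R` is a hull set of `G`. -/
def IsP3HullSet {V : Type*} (G : SimpleGraph V) (R : Set V) : Prop :=
  p3Hull G R = Set.univ

/-- One step of the process: add to `S` all the vertices with at least two neighbours in `S`. -/
def p3Interval {V : Type*} (G : SimpleGraph V) (S : Set V) : Set V :=
  S ∪ {v : V | ∃ u w : V, u ≠ w ∧ G.Adj v u ∧ G.Adj v w ∧ u ∈ S ∧ w ∈ S}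

/-- The sets `R_0 = R`, `R_1`, `R_2`, … of the percolation process started at `R`. -/
def percolationStep {V : Type*} (G : SimpleGraph V) (R : Set V) : ℕ → Set V
  | 0 => R
  | t + 1 => p3Interval G (percolationStep G R t)

/-- The least `t` with `R_t = V(G)`, for a hull set `R` of a finite graph. -/
noncomputable def hullSetTime {V : Type*} (G : SimpleGraph V) (R : Set V) : ℕ :=
  sInf {t : ℕ | percolationStep G R t = Set.univ}

/-- The percolation time: the maximum of `hullSetTime G R` over all the hull sets `R`. (For a
finite graph this is a finite nonempty set of values, since `V(G)` itself is a hull set.) -/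
noncomputable def percolationTime {V : Type*} (G : SimpleGraph V) : ℕ :=
  sSup {t : ℕ | ∃ R : Set V, IsP3HullSet G R ∧ t = hullSetTime G R}

/-- `P` is a dominating path whose two endpoints are leaves. -/
def IsLeafDominatingPath {V : Type*} [Fintype V] (G : SimpleGraph V) [DecidableRel G.Adj]
    {a b : V} (P : G.Walk a b) : Prop :=
  P.IsPath ∧ a ≠ b ∧ G.degree a = 1 ∧ G.degree b = 1 ∧
    ∀ v : V, v ∉ P.support → ∃ w ∈ P.support, G.Adj v w

/-- The sequence of the reduced degrees `min (deg v) 4` along the vertices of a walk. -/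
def reducedDegreeSequence {V : Type*} [Fintype V] (G : SimpleGraph V) [DecidableRel G.Adj]
    {a b : V} (P : G.Walk a b) : List ℕ :=
  P.support.map fun v => min (G.degree v) 4

namespace PercolationSequence

/-! Below, `s` is a reduced degree sequence; its terms are indexed from `0`. -/

/-- The `i`-th term of `s`. -/
def term (s : List ℕ) (i : ℕ) : ℕ := s.getD i 0

/-- The labels `ℓ(i)`: constant on each maximal block of consecutive terms equal to `3`,
increasing by one at every other step. -/
def label (s : List ℕ) : ℕ → ℕ
  | 0 => 1
  | i + 1 =>
    if term s (i + 1) ≠ 3 ∨ (term s (i + 1) = 3 ∧ term s i ≠ 3) then label s i + 1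
    else label s i

/-- `n(i)`: the least index with the same label as `i`. -/
def first (s : List ℕ) (i : ℕ) : ℕ :=
  Nat.find (p := fun j => label s j = label s i) ⟨i, rfl⟩

/-- `m(i)`: the greatest index of `s` with the same label as `i`. -/
def last (s : List ℕ) (i : ℕ) : ℕ :=
  Nat.findGreatest (fun j => label s j = label s i) (s.length - 1)

/-- The value of the percolation sequence at an index `i` of a block of terms equal to `3`,
according to the terms just before and just after the block. -/
def blockValue (s : List ℕ) (i : ℕ) : ℕ :=
  let x := i - first s i
  let y := last s i - i
  match term s (first s i - 1), term s (last s i + 1) with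
  | 1, 1 => min x y + 1
  | 2, 2 => max x y + 1
  | 1, 2 => x + 1
  | 2, 1 => y + 1
  | 1, 4 => min (x + 1) (y + 2)
  | 4, 1 => min (x + 2) (y + 1)
  | 4, 2 => x + 2
  | 2, 4 => y + 2
  | 4, 4 => min x y + 2
  | _, _ => 0

/-- The percolation sequence at the indices whose term is `1`, `3` or `4`. -/
def baseValue (s : List ℕ) (i : ℕ) : ℕ :=
  match term s i with
  | 1 => 0
  | 3 => blockValue s i
  | 4 => 1
  | _ => 0

/-- The percolation sequence. At an index `i` with term `2`, only neighbouring indices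
with term `3` or `4` are referred to, and there the sequence is given by `baseValue`. -/
def value (s : List ℕ) (i : ℕ) : ℕ :=
  if term s i = 2 then
    if term s (i - 1) ∈ ({1, 2} : Finset ℕ) then
      if term s (i + 1) ∈ ({1, 2} : Finset ℕ) then 1
      else baseValue s (i + 1) + 1
    else
      if term s (i + 1) ∈ ({1, 2} : Finset ℕ) then baseValue s (i - 1) + 1
      else max (baseValue s (i - 1)) (baseValue s (i + 1)) + 1
  else baseValue s i

/-- The maximum entry of the percolation sequence. -/
def maxValue (s : List ℕ) : ℕ := (Finset.range s.length).sup (value s)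

end PercolationSequence

/-!
A hull set `R` is recovered from the infection times of the vertices, and the functions `t` that
arise as infection times are characterised locally (`IsTimeFunction`): a vertex with `0 < t v` has
two neighbours infected earlier, and is infected at most one step after any two of its neighbours.

A vertex off the dominating path is a leaf, so its time is `0`, and `t` amounts to a sequence of
times along the path. Between two path neighbours, a vertex of degree `2` waits for both, a vertex
of degree `3` waits for one of them because its leaf is infected from the start, and a vertex of
degree at least `4` has two such leaves and is infected by time `1`. Along a block of terms `3` the
times therefore change by at most one per step as long as they are positive, so they are bounded by
the distance to an end of the block plus the time at that end, which is `0` for a leaf and at most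
`1` for a vertex of degree at least `4`. An end of degree `2` gives no bound; if both ends have
degree `2`, then the minimum of the times over the block and its ends must be `0`. Sequences that
are linear on a block, or the minimum of two linear ones, and vanish elsewhere attain the bounds.

As for existence, a longest path among those through all vertices that are not leaves has leaves as
ends, and it is dominating because a connected graph with two adjacent leaves has no other vertex.
-/

/-- The local condition on infection times `t` at a vertex `v` outside of the initial set: some two
neighbours of `v` are infected before `v`, and `v` is infected at most one step after any two of
its neighbours. -/
def IsConsistentAt {V : Type*} (G : SimpleGraph V) (t : V → ℕ) (v : V) : Prop :=
  (∃ u w, u ≠ w ∧ G.Adj v u ∧ G.Adj v w ∧ t u < t v ∧ t w < t v) ∧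
    ∀ u w, u ≠ w → G.Adj v u → G.Adj v w → t v ≤ max (t u) (t w) + 1

/-- The functions giving the infection times of the vertices in the percolation started at some
hull set. The initial set is implicit: it is the zero set of `t`. -/
def IsTimeFunction {V : Type*} (G : SimpleGraph V) (t : V → ℕ) : Prop :=
  ∀ v, 0 < t v → IsConsistentAt G t v

/-- The time at which `v` is reached by the percolation started at `R`; it is `0` by convention if
`v` is never reached. -/
noncomputable def infectionTime {V : Type*} (G : SimpleGraph V) (R : Set V) (v : V) : ℕ :=
  sInf {s : ℕ | v ∈ percolationStep G R s}

section Percolation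

variable {V : Type*} {G : SimpleGraph V} {R : Set V} {t : V → ℕ} {v : V} {s : ℕ}

theorem percolationStep_mono (G : SimpleGraph V) (R : Set V) : Monotone (percolationStep G R) :=
  monotone_nat_of_le_succ fun _ => Set.subset_union_left

theorem percolationStep_subset_p3Hull (G : SimpleGraph V) (R : Set V) (s : ℕ) :
    percolationStep G R s ⊆ p3Hull G R := by
  rintro v hv S ⟨hS, hRS⟩
  induction s generalizing v with
  | zero => exact hRS hv
  | succ s ih =>
    rcases hv with hv | ⟨u, w, huw, hu, hw, hus, hws⟩
    · exact ih hv
    · exact hS u v w huw hu.symm hw (ih hus) (ih hws)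

theorem isP3Convex_iUnion_percolationStep (G : SimpleGraph V) (R : Set V) :
    IsP3Convex G (⋃ s, percolationStep G R s) := by
  intro u v w huw hu hw hus hws
  obtain ⟨s, hs⟩ := Set.mem_iUnion.1 hus
  obtain ⟨s', hs'⟩ := Set.mem_iUnion.1 hws
  exact Set.mem_iUnion.2 ⟨max s s' + 1, Or.inr ⟨u, w, huw, hu.symm, hw,
    percolationStep_mono G R (le_max_left _ _) hs, percolationStep_mono G R (le_max_right _ _) hs'⟩⟩

theorem IsP3HullSet.iUnion_percolationStep (hR : IsP3HullSet G R) :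
    ⋃ s, percolationStep G R s = Set.univ :=
  Set.univ_subset_iff.1 <| hR ▸ Set.sInter_subset_of_mem
    ⟨isP3Convex_iUnion_percolationStep G R, Set.subset_iUnion (percolationStep G R) 0⟩

theorem infectionTime_le (h : v ∈ percolationStep G R s) : infectionTime G R v ≤ s :=
  Nat.sInf_le h

theorem IsP3HullSet.mem_percolationStep_infectionTime (hR : IsP3HullSet G R) (v : V) :
    v ∈ percolationStep G R (infectionTime G R v) :=
  Nat.sInf_mem <| Set.mem_iUnion.1 <| hR.iUnion_percolationStep ▸ Set.mem_univ v

theorem IsP3HullSet.setOf_infectionTime_eq_zero (hR : IsP3HullSet G R) :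
    {v | infectionTime G R v = 0} = R := by
  ext v
  exact ⟨fun h => by simpa [show infectionTime G R v = 0 from h] using!
    hR.mem_percolationStep_infectionTime v, fun h => Nat.le_zero.1 (infectionTime_le h)⟩

theorem IsP3HullSet.isTimeFunction_infectionTime (hR : IsP3HullSet G R) :
    IsTimeFunction G (infectionTime G R) := by
  intro v hv
  refine ⟨?_, fun u w huw hu hw => infectionTime_le <| Or.inr ⟨u, w, huw, hu, hw,
    percolationStep_mono G R (le_max_left _ _) (hR.mem_percolationStep_infectionTime u),
    percolationStep_mono G R (le_max_right _ _) (hR.mem_percolationStep_infectionTime w)⟩⟩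
  obtain ⟨s, hs⟩ := Nat.exists_eq_succ_of_ne_zero hv.ne'
  have hmem := hR.mem_percolationStep_infectionTime v
  rw [hs] at hmem
  rcases hmem with hmem | ⟨u, w, huw, hu, hw, hus, hws⟩
  · exact absurd (infectionTime_le hmem) (by omega)
  · exact ⟨u, w, huw, hu, hw, by have := infectionTime_le hus; omega,
      by have := infectionTime_le hws; omega⟩

namespace IsTimeFunction

theorem percolationStep_eq (ht : IsTimeFunction G t) (s : ℕ) :
    percolationStep G {v | t v = 0} s = {v | t v ≤ s} := by
  induction s with
  | zero => simp only [percolationStep, Nat.le_zero]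
  | succ s ih =>
    rw [percolationStep, ih]
    ext v
    constructor
    · rintro (h | ⟨u, w, huw, hu, hw, hus, hws⟩)
      · exact Nat.le_succ_of_le h
      · rcases Nat.eq_zero_or_pos (t v) with h0 | hpos
        · exact h0.trans_le (Nat.zero_le _)
        · exact ((ht v hpos).2 u w huw hu hw).trans (Nat.succ_le_succ (max_le hus hws))
    · intro (h : t v ≤ s + 1)
      rcases Nat.eq_zero_or_pos (t v) with h0 | hpos
      · exact Or.inl (h0.trans_le (Nat.zero_le _))
      · obtain ⟨u, w, huw, hu, hw, htu, htw⟩ := (ht v hpos).1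
        exact Or.inr ⟨u, w, huw, hu, hw, Nat.lt_succ_iff.1 (htu.trans_le h),
          Nat.lt_succ_iff.1 (htw.trans_le h)⟩

theorem percolationStep_eq_univ_iff (ht : IsTimeFunction G t) :
    percolationStep G {v | t v = 0} s = Set.univ ↔ ∀ v, t v ≤ s := by
  rw [ht.percolationStep_eq, Set.eq_univ_iff_forall]
  rfl

theorem le_percolationTime [Finite V] (ht : IsTimeFunction G t) (v : V) :
    t v ≤ percolationTime G := by
  obtain ⟨B, hB⟩ := (Set.finite_range t).bddAbove
  have hstep : percolationStep G {v | t v = 0} B = Set.univ :=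
    ht.percolationStep_eq_univ_iff.2 fun v => hB ⟨v, rfl⟩
  have hhull : IsP3HullSet G {v | t v = 0} :=
    Set.univ_subset_iff.1 (hstep ▸ percolationStep_subset_p3Hull G _ B)
  have htime : percolationStep G {v | t v = 0} (hullSetTime G {v | t v = 0}) = Set.univ :=
    Nat.sInf_mem (s := {s | percolationStep G {v | t v = 0} s = Set.univ}) ⟨B, hstep⟩
  have hbdd : BddAbove {s | ∃ R : Set V, IsP3HullSet G R ∧ s = hullSetTime G R} := by
    refine ((Set.finite_range (hullSetTime G)).subset ?_).bddAbove
    rintro _ ⟨R, -, rfl⟩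
    exact ⟨R, rfl⟩
  exact (ht.percolationStep_eq_univ_iff.1 htime v).trans (le_csSup hbdd ⟨_, hhull, rfl⟩)

theorem eq_zero_of_subsingleton_neighborSet (ht : IsTimeFunction G t)
    (hv : (G.neighborSet v).Subsingleton) : t v = 0 := by
  by_contra hne
  obtain ⟨u, w, huw, hu, hw, -, -⟩ := (ht v (Nat.pos_of_ne_zero hne)).1
  exact huw (hv hu hw)

end IsTimeFunction

theorem percolationTime_le {B : ℕ} (h : ∀ t, IsTimeFunction G t → ∀ v, t v ≤ B) :
    percolationTime G ≤ B := by
  refine csSup_le' ?_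
  rintro _ ⟨R, hR, rfl⟩
  have ht := hR.isTimeFunction_infectionTime
  have hstep := ht.percolationStep_eq_univ_iff.2 (h _ ht)
  rw [hR.setOf_infectionTime_eq_zero] at hstep
  exact Nat.sInf_le hstep

end Percolation

namespace PercolationSequence

/-- The properties of the reduced degree sequence of a leaf dominating path that are used: its ends,
and only its ends, are leaves. -/
structure IsReducedDegreeSequence (s : List ℕ) : Prop where
  zero : term s 0 = 1
  last : term s (s.length - 1) = 1
  inner : ∀ i, 0 < i → i + 1 < s.length → term s i = 2 ∨ term s i = 3 ∨ term s i = 4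

/-- The times of infection along a leaf dominating path with reduced degree sequence `s`, for a
time function of the tree. Each term of `s` imposes a condition on the times at its index and the
two adjacent ones; beyond the end of `s` there is no condition, since there `term s i = 0`. -/
structure IsTimeSequence (s : List ℕ) (τ : ℕ → ℕ) : Prop where
  one : ∀ i, term s i = 1 → τ i = 0
  two : ∀ i, term s (i + 1) = 2 → 0 < τ (i + 1) →
    τ i < τ (i + 1) ∧ τ (i + 2) < τ (i + 1) ∧ τ (i + 1) ≤ max (τ i) (τ (i + 2)) + 1
  three : ∀ i, term s (i + 1) = 3 → 0 < τ (i + 1) →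
    (τ i < τ (i + 1) ∨ τ (i + 2) < τ (i + 1)) ∧ τ (i + 1) ≤ τ i + 1 ∧ τ (i + 1) ≤ τ (i + 2) + 1
  four : ∀ i, term s i = 4 → τ i ≤ 1

/-- `p` and `q` are the indices just before and just after a maximal block, possibly empty, of
terms equal to `3`. -/
structure IsBlock (s : List ℕ) (p q : ℕ) : Prop where
  lt : p < q
  lt_length : q < s.length
  eq_three : ∀ j, p < j → j < q → term s j = 3
  left_ne_three : term s p ≠ 3
  right_ne_three : term s q ≠ 3

/-- The greatest time that an end of a block of terms `3` with reduced degree `a` can contribute to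
the block: `0` for a leaf, `1` for reduced degree `4`. An end of degree `2` waits for the block and
contributes nothing, which is encoded by the value `0`. -/
def endTime (a : ℕ) : ℕ := if a = 4 then 1 else 0

variable {s : List ℕ} {τ : ℕ → ℕ} {p q i j : ℕ}

namespace IsReducedDegreeSequence

theorem interior_of_ne_one (hs : IsReducedDegreeSequence s) (hi : i < s.length)
    (h1 : term s i ≠ 1) : 0 < i ∧ i + 1 < s.length := by
  have hzero : i ≠ 0 := by rintro rfl; exact h1 hs.zero
  have hlast : i ≠ s.length - 1 := by rintro rfl; exact h1 hs.last
  omega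

theorem term_mem (hs : IsReducedDegreeSequence s) (hi : i < s.length) :
    term s i = 1 ∨ term s i = 2 ∨ term s i = 3 ∨ term s i = 4 := by
  by_cases h1 : term s i = 1
  · exact Or.inl h1
  · obtain ⟨h0, hl⟩ := hs.interior_of_ne_one hi h1
    exact Or.inr (hs.inner i h0 hl)

theorem exists_left_end (hs : IsReducedDegreeSequence s) (i : ℕ) :
    ∃ p ≤ i, term s p ≠ 3 ∧ ∀ j, p < j → j ≤ i → term s j = 3 := by
  induction i with
  | zero => exact ⟨0, le_rfl, by simp [hs.zero], fun j h0 h => absurd h0 h.not_gt⟩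
  | succ i ih =>
    by_cases h3 : term s (i + 1) = 3
    · obtain ⟨p, hpi, hp, hblock⟩ := ih
      refine ⟨p, hpi.trans i.le_succ, hp, fun j hpj hj => ?_⟩
      rcases hj.eq_or_lt with rfl | hj
      · exact h3
      · exact hblock j hpj (Nat.lt_succ_iff.1 hj)
    · exact ⟨i + 1, le_rfl, h3, fun j hij h => absurd hij h.not_gt⟩

theorem exists_right_end (hs : IsReducedDegreeSequence s) (hi : i < s.length) :
    ∃ q, i ≤ q ∧ q < s.length ∧ term s q ≠ 3 ∧ ∀ j, i ≤ j → j < q → term s j = 3 := by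
  have hlast : i ≤ s.length - 1 ∧ term s (s.length - 1) ≠ 3 := ⟨by omega, by simp [hs.last]⟩
  have hex : ∃ q, i ≤ q ∧ term s q ≠ 3 := ⟨_, hlast⟩
  obtain ⟨hiq, hq⟩ := Nat.find_spec hex
  refine ⟨Nat.find hex, hiq, (Nat.find_min' hex hlast).trans_lt (by omega), hq, fun j hij hj => ?_⟩
  exact not_not.1 fun h => Nat.find_min hex hj ⟨hij, h⟩

theorem exists_isBlock (hs : IsReducedDegreeSequence s) (hi : i < s.length) (h3 : term s i = 3) :
    ∃ p q, p < i ∧ i < q ∧ IsBlock s p q := by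
  obtain ⟨p, hpi, hp, hleft⟩ := hs.exists_left_end i
  obtain ⟨q, hiq, hqs, hq, hright⟩ := hs.exists_right_end hi
  have hpi : p < i := hpi.lt_of_ne (by rintro rfl; exact hp h3)
  have hiq : i < q := hiq.lt_of_ne (by rintro rfl; exact hq h3)
  refine ⟨p, q, hpi, hiq, hpi.trans hiq, hqs, fun j hpj hjq => ?_, hp, hq⟩
  exact (le_total j i).elim (hleft j hpj) (hright j · hjq)

end IsReducedDegreeSequence

theorem label_succ (s : List ℕ) (i : ℕ) :
    label s (i + 1) = if term s i = 3 ∧ term s (i + 1) = 3 then label s i else label s i + 1 := by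
  grind [label]

theorem label_mono (s : List ℕ) : Monotone (label s) :=
  monotone_nat_of_le_succ fun i => by grind [label_succ]

theorem label_lt_of_ne_three (hij : i < j) (h : term s i ≠ 3 ∨ term s j ≠ 3) :
    label s i < label s j := by
  rcases h with h | h
  · refine lt_of_lt_of_le ?_ (label_mono s hij)
    grind [label_succ]
  · obtain ⟨j, rfl⟩ := Nat.exists_eq_add_one_of_ne_zero (Nat.ne_zero_of_lt hij)
    refine (label_mono s (Nat.lt_succ_iff.1 hij)).trans_lt ?_
    grind [label_succ]

namespace IsBlock

theorem label_eq (hB : IsBlock s p q) (hpi : p < i) (hiq : i < q) :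
    label s i = label s (p + 1) := by
  induction i, hpi using Nat.le_induction with
  | base => rfl
  | succ i hpi ih =>
    rw [label_succ, if_pos ⟨hB.eq_three i hpi (by omega), hB.eq_three _ (by omega) hiq⟩]
    exact ih (by omega)

theorem first_eq (hB : IsBlock s p q) (hpi : p < i) (hiq : i < q) : first s i = p + 1 := by
  rw [first, Nat.find_eq_iff]
  refine ⟨(hB.label_eq hpi hiq).symm, fun j hj => ne_of_lt ?_⟩
  calc label s j ≤ label s p := label_mono s (Nat.lt_succ_iff.1 hj)
    _ < label s i := label_lt_of_ne_three hpi (Or.inl hB.left_ne_three)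

theorem last_eq (hB : IsBlock s p q) (hpi : p < i) (hiq : i < q) : last s i = q - 1 := by
  have hq := hB.lt_length
  rw [last, Nat.findGreatest_eq_iff]
  refine ⟨by omega, fun _ => ?_, fun j hj _ => ne_of_gt ?_⟩
  · rw [hB.label_eq hpi hiq, hB.label_eq (by omega) (by omega)]
  · calc label s i < label s q := label_lt_of_ne_three hiq (Or.inr hB.right_ne_three)
      _ ≤ label s j := label_mono s (by omega)

theorem baseValue_eq (hs : IsReducedDegreeSequence s) (hB : IsBlock s p q) (hpi : p < i)
    (hiq : i < q) :
    baseValue s i =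
      if term s p = 2 then
        if term s q = 2 then max (i - p) (q - i) else q - i + endTime (term s q)
      else
        if term s q = 2 then i - p + endTime (term s p)
        else min (i - p + endTime (term s p)) (q - i + endTime (term s q)) := by
  have hbase : baseValue s i = blockValue s i := by simp only [baseValue, hB.eq_three i hpi hiq]
  have hp : term s p = 1 ∨ term s p = 2 ∨ term s p = 4 := by
    have := hs.term_mem (hB.lt.trans hB.lt_length)
    have := hB.left_ne_three
    tauto
  have hq : term s q = 1 ∨ term s q = 2 ∨ term s q = 4 := by
    have := hs.term_mem hB.lt_length
    have := hB.right_ne_three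
    tauto
  have hq1 : q - 1 + 1 = q := by omega
  rw [hbase, blockValue, hB.first_eq hpi hiq, hB.last_eq hpi hiq, Nat.add_sub_cancel, hq1]
  rcases hp with ha | ha | ha <;> rcases hq with hb | hb | hb <;>
    simp only [ha, hb, endTime] <;> grind

end IsBlock

theorem baseValue_of_ne_three (h3 : term s i ≠ 3) : baseValue s i = endTime (term s i) := by
  grind [baseValue, endTime]

theorem baseValue_of_isBlock_of_right (hs : IsReducedDegreeSequence s)
    (hB : IsBlock s p (i + 1)) (h2 : term s (i + 1) = 2) :
    baseValue s i = i - p + endTime (term s p) := by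
  rcases (Nat.lt_succ_iff.1 hB.lt).eq_or_lt with rfl | hpi
  · rw [baseValue_of_ne_three hB.left_ne_three, Nat.sub_self, Nat.zero_add]
  · rw [hB.baseValue_eq hs hpi i.lt_succ_self]
    grind [endTime]

theorem baseValue_of_isBlock_of_left (hs : IsReducedDegreeSequence s)
    (hB : IsBlock s i q) (h2 : term s i = 2) :
    baseValue s (i + 1) = q - (i + 1) + endTime (term s q) := by
  rcases (Nat.succ_le_iff.2 hB.lt).eq_or_lt with rfl | hiq
  · rw [baseValue_of_ne_three hB.right_ne_three, Nat.sub_self, Nat.zero_add]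
  · rw [hB.baseValue_eq hs i.lt_succ_self hiq]
    grind [endTime]

theorem value_of_term_ne_two (h2 : term s i ≠ 2) : value s i = baseValue s i := if_neg h2

/-- The case distinction in `value` disappears because `baseValue` vanishes at the terms `1`
and `2`. -/
theorem value_of_term_eq_two (h2 : term s (i + 1) = 2) :
    value s (i + 1) = max (baseValue s i) (baseValue s (i + 2)) + 1 := by
  have hzero : ∀ j, term s j ∈ ({1, 2} : Finset ℕ) → baseValue s j = 0 := by
    intro j hj
    grind [baseValue]
  rw [value, if_pos h2, Nat.add_sub_cancel]
  grind

namespace IsTimeSequence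

theorem le_add_left (hτ : IsTimeSequence s τ) (hpi : p ≤ i)
    (h3 : ∀ j, p < j → j ≤ i → term s j = 3) : τ i ≤ τ p + (i - p) := by
  induction i, hpi using Nat.le_induction with
  | base => simp
  | succ i hpi ih =>
    have hi := ih fun j hpj hji => h3 j hpj (by omega)
    have hstep := hτ.three i (h3 (i + 1) (by omega) le_rfl)
    omega

theorem le_add_right (hτ : IsTimeSequence s τ) (hpos : 0 < i) (hiq : i ≤ q)
    (h3 : ∀ j, i ≤ j → j < q → term s j = 3) : τ i ≤ τ q + (q - i) := by
  induction q, hiq using Nat.le_induction with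
  | base => simp
  | succ q hiq ih =>
    have hi := ih fun j hij hjq => h3 j hij (by omega)
    obtain ⟨q, rfl⟩ := Nat.exists_eq_add_one_of_ne_zero (hpos.trans_le hiq).ne'
    have hstep := hτ.three q (h3 (q + 1) hiq (by omega))
    change τ i ≤ τ (q + 2) + (q + 2 - i)
    omega

theorem le_endTime (hτ : IsTimeSequence s τ) (h : term s i = 1 ∨ term s i = 4) :
    τ i ≤ endTime (term s i) := by
  rcases h with h | h
  · exact (hτ.one i h).trans_le (Nat.zero_le _)
  · rw [endTime, if_pos h]
    exact hτ.four i h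

/-- A least time on the block and its ends cannot be positive: each index would have an adjacent
one, still within these, with a smaller time. -/
theorem exists_eq_zero (hτ : IsTimeSequence s τ) (hs : IsReducedDegreeSequence s)
    (hB : IsBlock s p q) (hp : term s p = 2) (hq : term s q = 2) :
    ∃ j, p ≤ j ∧ j ≤ q ∧ τ j = 0 := by
  obtain ⟨j, hj, hmin⟩ := Finset.exists_min_image (Finset.Icc p q) τ
    ⟨p, Finset.left_mem_Icc.2 hB.lt.le⟩
  simp only [Finset.mem_Icc] at hj hmin
  refine ⟨j, hj.1, hj.2, by_contra fun hne => ?_⟩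
  have hpos : 0 < p := (hs.interior_of_ne_one (hB.lt.trans hB.lt_length) (by omega)).1
  obtain ⟨j, rfl⟩ : ∃ l, j = l + 1 := ⟨j - 1, by omega⟩
  have hprev := hmin j
  have hnext := hmin (j + 2)
  rcases hj.1.eq_or_lt with rfl | hpj
  · have := hτ.two j hp (by omega)
    have := hB.lt
    omega
  rcases hj.2.eq_or_lt with rfl | hjq
  · have := hτ.two j hq (by omega)
    omega
  · have := hτ.three j (hB.eq_three _ hpj hjq) (by omega)
    omega

theorem le_max_of_two_two (hτ : IsTimeSequence s τ) (hs : IsReducedDegreeSequence s)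
    (hB : IsBlock s p q) (hp : term s p = 2) (hq : term s q = 2) (hpi : p < i) (hiq : i < q) :
    τ i ≤ max (i - p) (q - i) := by
  obtain ⟨j, hpj, hjq, hj⟩ := hτ.exists_eq_zero hs hB hp hq
  rcases le_total j i with hji | hij
  · have := hτ.le_add_left hji fun l hjl hli => hB.eq_three l (by omega) (by omega)
    omega
  · have := hτ.le_add_right (by omega) hij fun l hil hlj => hB.eq_three l (by omega) (by omega)
    omega

theorem le_baseValue (hτ : IsTimeSequence s τ) (hs : IsReducedDegreeSequence s)
    (hi : i < s.length) (h2 : term s i ≠ 2) : τ i ≤ baseValue s i := by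
  by_cases h3 : term s i = 3
  · obtain ⟨p, q, hpi, hiq, hB⟩ := hs.exists_isBlock hi h3
    have hleft := hτ.le_add_left hpi.le fun j hpj hji => hB.eq_three j hpj (by omega)
    have hright := hτ.le_add_right (by omega) hiq.le fun j hij hjq => hB.eq_three j (by omega) hjq
    have hp : term s p ≠ 2 → τ p ≤ endTime (term s p) := fun hp2 => hτ.le_endTime <| by
      have := hs.term_mem (hpi.trans hi)
      have := hB.left_ne_three
      tauto
    have hq : term s q ≠ 2 → τ q ≤ endTime (term s q) := fun hq2 => hτ.le_endTime <| by
      have := hs.term_mem hB.lt_length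
      have := hB.right_ne_three
      tauto
    have h22 := hτ.le_max_of_two_two hs hB (hpi := hpi) (hiq := hiq)
    rw [hB.baseValue_eq hs hpi hiq]
    split_ifs with hp2 hq2 hq2
    · exact h22 hp2 hq2
    · have := hq hq2; omega
    · have := hp hp2; omega
    · have := hp hp2; have := hq hq2; omega
  · rw [baseValue_of_ne_three h3]
    have := hs.term_mem hi
    exact hτ.le_endTime (by tauto)

theorem le_value (hτ : IsTimeSequence s τ) (hs : IsReducedDegreeSequence s) (hi : i < s.length) :
    τ i ≤ value s i := by
  by_cases h2 : term s i = 2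
  swap
  · exact (hτ.le_baseValue hs hi h2).trans_eq (value_of_term_ne_two h2).symm
  obtain ⟨hpos, hlast⟩ := hs.interior_of_ne_one hi (by omega)
  obtain ⟨i, rfl⟩ := Nat.exists_eq_add_one_of_ne_zero hpos.ne'
  rcases Nat.eq_zero_or_pos (τ (i + 1)) with h0 | hτpos
  · exact h0.trans_le (Nat.zero_le _)
  obtain ⟨hprev, hnext, hle⟩ := hτ.two i h2 hτpos
  have hprev' : τ i ≤ baseValue s i := by
    by_cases hi2 : term s i = 2
    · obtain ⟨j, rfl⟩ := Nat.exists_eq_add_one_of_ne_zero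
        (hs.interior_of_ne_one (i := i) (by omega) (by omega)).1.ne'
      have : ¬ 0 < τ (j + 1) := fun h => (hτ.two j hi2 h).2.1.not_gt hprev
      omega
    · exact hτ.le_baseValue hs (by omega) hi2
  have hnext' : τ (i + 2) ≤ baseValue s (i + 2) := by
    by_cases hi2 : term s (i + 2) = 2
    · have : ¬ 0 < τ (i + 2) := fun h => (hτ.two (i + 1) hi2 h).1.not_gt hnext
      omega
    · exact hτ.le_baseValue hs hlast hi2
  rw [value_of_term_eq_two h2]
  omega

end IsTimeSequence

theorem isTimeSequence_single (s : List ℕ) (i : ℕ) :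
    IsTimeSequence s (Pi.single i (endTime (term s i))) := by
  constructor <;> grind [endTime]

namespace IsBlock

theorem isTimeSequence_min (hB : IsBlock s p q) :
    IsTimeSequence s fun j =>
      if p ≤ j ∧ j ≤ q then min (j - p + endTime (term s p)) (q - j + endTime (term s q))
      else 0 := by
  obtain ⟨hpq, -, h3, hp, hq⟩ := hB
  constructor <;> grind [endTime]

theorem isTimeSequence_of_right (hB : IsBlock s p q) (h2 : term s q = 2) :
    IsTimeSequence s fun j =>
      if p ≤ j ∧ j ≤ q then j - p + endTime (term s p) else 0 := by
  obtain ⟨hpq, -, h3, hp, hq⟩ := hB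
  constructor <;> grind [endTime]

theorem isTimeSequence_of_left (hB : IsBlock s p q) (h2 : term s p = 2) :
    IsTimeSequence s fun j =>
      if p ≤ j ∧ j ≤ q then q - j + endTime (term s q) else 0 := by
  obtain ⟨hpq, -, h3, hp, hq⟩ := hB
  constructor <;> grind [endTime]

theorem exists_eq_baseValue (hB : IsBlock s p q) (hs : IsReducedDegreeSequence s) (hpi : p < i)
    (hiq : i < q) : ∃ τ, IsTimeSequence s τ ∧ τ i = baseValue s i := by
  rw [hB.baseValue_eq hs hpi hiq]
  have hmem : p ≤ i ∧ i ≤ q := ⟨hpi.le, hiq.le⟩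
  split_ifs with hp hq hq
  · rcases le_total (i - p) (q - i) with h | h
    · exact ⟨_, hB.isTimeSequence_of_left hp, by simp [hmem, hq, endTime, h]⟩
    · exact ⟨_, hB.isTimeSequence_of_right hq, by simp [hmem, hp, endTime, h]⟩
  · exact ⟨_, hB.isTimeSequence_of_left hp, if_pos hmem⟩
  · exact ⟨_, hB.isTimeSequence_of_right hq, if_pos hmem⟩
  · exact ⟨_, hB.isTimeSequence_min, if_pos hmem⟩

end IsBlock

namespace IsReducedDegreeSequence

theorem exists_eq_value (hs : IsReducedDegreeSequence s) (hi : i < s.length) :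
    ∃ τ, IsTimeSequence s τ ∧ τ i = value s i := by
  by_cases h2 : term s i = 2
  swap
  · rw [value_of_term_ne_two h2]
    by_cases h3 : term s i = 3
    · obtain ⟨p, q, hpi, hiq, hB⟩ := hs.exists_isBlock hi h3
      exact hB.exists_eq_baseValue hs hpi hiq
    · exact ⟨_, isTimeSequence_single s i, by simp [baseValue_of_ne_three h3]⟩
  obtain ⟨hpos, hlast⟩ := hs.interior_of_ne_one hi (by omega)
  obtain ⟨i, rfl⟩ := Nat.exists_eq_add_one_of_ne_zero hpos.ne'
  rw [value_of_term_eq_two h2]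
  rcases le_total (baseValue s (i + 2)) (baseValue s i) with h | h
  · obtain ⟨p, hpi, hp, hleft⟩ := hs.exists_left_end i
    have hB : IsBlock s p (i + 1) :=
      ⟨by omega, hi, fun j hpj hj => hleft j hpj (by omega), hp, by omega⟩
    refine ⟨_, hB.isTimeSequence_of_right h2, ?_⟩
    rw [if_pos (by omega), max_eq_left h, baseValue_of_isBlock_of_right hs hB h2]
    omega
  · obtain ⟨q, hiq, hqs, hq, hright⟩ := hs.exists_right_end hlast
    have hB : IsBlock s (i + 1) q :=
      ⟨by omega, hqs, fun j hj hjq => hright j (by omega) hjq, by omega, hq⟩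
    refine ⟨_, hB.isTimeSequence_of_left h2, ?_⟩
    rw [if_pos (by omega), max_eq_right h, baseValue_of_isBlock_of_left hs hB h2]
    omega

end IsReducedDegreeSequence

end PercolationSequence

section Consistency

variable {V : Type*} {G : SimpleGraph V} {t : V → ℕ} {v x y z : V}

theorem isConsistentAt_iff_of_adj_iff_pair (hxy : x ≠ y)
    (hadj : ∀ w, G.Adj v w ↔ w = x ∨ w = y) :
    IsConsistentAt G t v ↔ t x < t v ∧ t y < t v ∧ t v ≤ max (t x) (t y) + 1 := by
  have hx : G.Adj v x := (hadj x).2 (Or.inl rfl)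
  have hy : G.Adj v y := (hadj y).2 (Or.inr rfl)
  constructor
  · rintro ⟨⟨u, w, huw, hu, hw, htu, htw⟩, hle⟩
    have := hle x y hxy hx hy
    grind
  · rintro ⟨htx, hty, hle⟩
    exact ⟨⟨x, y, hxy, hx, hy, htx, hty⟩, by grind⟩

theorem isConsistentAt_iff_of_adj_iff_triple (hxz : x ≠ z) (hyz : y ≠ z)
    (hadj : ∀ w, G.Adj v w ↔ w = x ∨ w = y ∨ w = z) (hz : t z = 0) (hv : 0 < t v) :
    IsConsistentAt G t v ↔
      (t x < t v ∨ t y < t v) ∧ t v ≤ t x + 1 ∧ t v ≤ t y + 1 := by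
  have hvx : G.Adj v x := (hadj x).2 (Or.inl rfl)
  have hvy : G.Adj v y := (hadj y).2 (Or.inr (Or.inl rfl))
  have hvz : G.Adj v z := (hadj z).2 (Or.inr (Or.inr rfl))
  constructor
  · rintro ⟨⟨u, w, huw, hu, hw, htu, htw⟩, hle⟩
    have := hle x z hxz hvx hvz
    have := hle y z hyz hvy hvz
    grind
  · rintro ⟨htx | hty, hlex, hley⟩
    · exact ⟨⟨x, z, hxz, hvx, hvz, htx, hz.trans_lt hv⟩, by grind⟩
    · exact ⟨⟨y, z, hyz, hvy, hvz, hty, hz.trans_lt hv⟩, by grind⟩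

theorem isConsistentAt_iff_le_one (hxy : x ≠ y) (hx : G.Adj v x) (hy : G.Adj v y)
    (htx : t x = 0) (hty : t y = 0) (hv : 0 < t v) : IsConsistentAt G t v ↔ t v ≤ 1 := by
  constructor
  · intro h
    simpa [htx, hty] using h.2 x y hxy hx hy
  · exact fun h => ⟨⟨x, y, hxy, hx, hy, htx.trans_lt hv, hty.trans_lt hv⟩,
      fun u w _ _ _ => h.trans (Nat.le_add_left _ _)⟩

end Consistency

section DominatingPath

open SimpleGraph PercolationSequence

variable {V : Type*} {T : SimpleGraph V} {a b u v w : V} {P : T.Walk a b} {i : ℕ} {t : V → ℕ}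
  {τ : ℕ → ℕ}

theorem getVert_ne_getVert_add_two (hP : P.IsPath) (hi : i + 1 < P.length) :
    P.getVert i ≠ P.getVert (i + 2) := fun h => by
  have := hP.getVert_injOn (show i ≤ P.length by omega) (show i + 2 ≤ P.length by omega) h
  omega

theorem eq_getVert_of_adj_getVert (hT : T.IsAcyclic) (hP : P.IsPath) (hi : i + 1 ≤ P.length)
    (hadj : T.Adj (P.getVert (i + 1)) u) (hu : u ∈ P.support) :
    u = P.getVert i ∨ u = P.getVert (i + 2) := by
  obtain ⟨j, rfl, -⟩ := Walk.mem_support_iff_exists_getVert.1 hu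
  rcases le_or_gt j i with hji | hij
  · left
    have hmem : P.getVert j ∈ (P.take (i + 1)).support := by
      have := (P.take (i + 1)).getVert_mem_support j
      rwa [Walk.take_getVert, min_eq_right (by omega)] at this
    rw [hT.eq_penultimate_of_adj_end (hP.take (i + 1)) hadj hmem, Walk.penultimate,
      Walk.take_getVert, Walk.take_length]
    congr 1
    omega
  · right
    have hmem : P.getVert j ∈ (P.drop (i + 1)).support := by
      have := (P.drop (i + 1)).getVert_mem_support (j - (i + 1))
      rwa [Walk.drop_getVert, Nat.add_sub_cancel' hij] at this
    rw [hT.eq_snd_of_adj_start (hP.drop (i + 1)) hadj hmem, Walk.snd, Walk.drop_getVert]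

theorem eq_of_adj_of_walk (hT : T.IsAcyclic) (huv : T.Adj u v) (huw : T.Adj u w)
    (r : T.Walk v w) (hr : u ∉ r.support) : v = w := by
  classical
  have hpath : (Walk.cons huv r.bypass).IsPath :=
    r.bypass_isPath.cons fun h => hr (r.support_bypass_subset_support h)
  have hmem : w ∈ (Walk.cons huv r.bypass).support := Walk.end_mem_support _
  simpa using (hT.eq_snd_of_adj_start hpath huw hmem).symm

theorem subsingleton_neighborSet_of_notMem_support (hT : T.IsAcyclic)
    (hdom : ∀ v ∉ P.support, ∃ w ∈ P.support, T.Adj v w) (hu : u ∉ P.support) :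
    (T.neighborSet u).Subsingleton := by
  classical
  have havoid : ∀ v, u ≠ v → ∃ r : T.Walk a v, u ∉ r.support := by
    intro v huv
    by_cases hv : v ∈ P.support
    · exact ⟨P.takeUntil v hv, fun h => hu (P.support_takeUntil_subset_support hv h)⟩
    · obtain ⟨w, hw, hvw⟩ := hdom v hv
      refine ⟨(P.takeUntil w hw).concat hvw.symm, fun h => ?_⟩
      rw [Walk.support_concat, List.mem_append, List.mem_singleton] at h
      exact h.elim (fun h => hu (P.support_takeUntil_subset_support hw h)) huv
  intro v hv w hw
  obtain ⟨q, hq⟩ := havoid v hv.ne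
  obtain ⟨r, hr⟩ := havoid w hw.ne
  exact eq_of_adj_of_walk hT hv hw (q.reverse.append r) (by simp [hq, hr])

theorem exists_extend_getVert (hP : P.IsPath) (τ : ℕ → ℕ) :
    ∃ t : V → ℕ, (∀ v ∉ P.support, t v = 0) ∧ ∀ i ≤ P.length, t (P.getVert i) = τ i := by
  classical
  refine ⟨fun v => if v ∈ P.support then τ (P.support.idxOf v) else 0, fun v hv => if_neg hv,
    fun i hi => ?_⟩
  simp only [P.getVert_mem_support, if_true]
  rw [P.getVert_eq_support_getElem hi, List.Nodup.idxOf_getElem hP.support_nodup]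

variable [Fintype V] [DecidableRel T.Adj]

theorem subsingleton_neighborSet_iff_degree_le_one :
    (T.neighborSet v).Subsingleton ↔ T.degree v ≤ 1 := by
  rw [← card_neighborSet_eq_degree, Fintype.card_le_one_iff_subsingleton, Set.subsingleton_coe]

theorem length_reducedDegreeSequence (P : T.Walk a b) :
    (reducedDegreeSequence T P).length = P.length + 1 := by
  simp [reducedDegreeSequence]

theorem term_reducedDegreeSequence (hi : i ≤ P.length) :
    term (reducedDegreeSequence T P) i = min (T.degree (P.getVert i)) 4 := by
  have h : i < P.support.length := by rw [P.length_support]; omega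
  rw [P.getVert_eq_support_getElem hi]
  simp [term, reducedDegreeSequence, List.getD_eq_getElem?_getD, List.getElem?_eq_getElem h]

theorem le_length_of_term_ne_zero (h : term (reducedDegreeSequence T P) i ≠ 0) :
    i ≤ P.length := by
  by_contra hi
  exact h (List.getD_eq_default _ _ (by rw [length_reducedDegreeSequence]; omega))

open scoped Classical in
/-- The neighbours of `v` that do not lie on `P`. At an inner vertex of a path in a forest these
are all the neighbours except for the two adjacent to it on the path. -/
noncomputable def offNeighbors (P : T.Walk a b) (v : V) : Finset V :=
  {w ∈ T.neighborFinset v | w ∉ P.support}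

theorem mem_offNeighbors : w ∈ offNeighbors P v ↔ T.Adj v w ∧ w ∉ P.support := by
  simp [offNeighbors]

theorem adj_getVert_iff (hT : T.IsAcyclic) (hP : P.IsPath) (hi : i + 1 < P.length) :
    T.Adj (P.getVert (i + 1)) w ↔
      w = P.getVert i ∨ w = P.getVert (i + 2) ∨ w ∈ offNeighbors P (P.getVert (i + 1)) := by
  constructor
  · intro hw
    by_cases hmem : w ∈ P.support
    · have := eq_getVert_of_adj_getVert hT hP hi.le hw hmem
      tauto
    · exact Or.inr (Or.inr (mem_offNeighbors.2 ⟨hw, hmem⟩))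
  · rintro (rfl | rfl | hw)
    · exact (P.adj_getVert_succ (by omega)).symm
    · exact P.adj_getVert_succ hi
    · exact (mem_offNeighbors.1 hw).1

theorem getVert_notMem_offNeighbors (j : ℕ) : P.getVert j ∉ offNeighbors P v := fun h =>
  (mem_offNeighbors.1 h).2 (P.getVert_mem_support j)

theorem card_offNeighbors_add_two (hT : T.IsAcyclic) (hP : P.IsPath) (hi : i + 1 < P.length) :
    (offNeighbors P (P.getVert (i + 1))).card + 2 = T.degree (P.getVert (i + 1)) := by
  classical
  have hset : T.neighborFinset (P.getVert (i + 1)) =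
      insert (P.getVert i) (insert (P.getVert (i + 2)) (offNeighbors P (P.getVert (i + 1)))) := by
    ext w
    simp only [mem_neighborFinset, Finset.mem_insert, adj_getVert_iff hT hP hi]
  rw [← card_neighborFinset_eq_degree, hset, Finset.card_insert_of_notMem,
    Finset.card_insert_of_notMem (getVert_notMem_offNeighbors _)]
  simp [getVert_ne_getVert_add_two hP hi, getVert_notMem_offNeighbors]

theorem isConsistentAt_getVert_of_term_eq_two (hT : T.IsAcyclic) (hP : P.IsPath)
    (hi : i + 1 < P.length) (h2 : term (reducedDegreeSequence T P) (i + 1) = 2) :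
    IsConsistentAt T t (P.getVert (i + 1)) ↔
      t (P.getVert i) < t (P.getVert (i + 1)) ∧ t (P.getVert (i + 2)) < t (P.getVert (i + 1)) ∧
        t (P.getVert (i + 1)) ≤ max (t (P.getVert i)) (t (P.getVert (i + 2))) + 1 := by
  have hcard := card_offNeighbors_add_two hT hP hi
  rw [term_reducedDegreeSequence hi.le] at h2
  have hoff : offNeighbors P (P.getVert (i + 1)) = ∅ := Finset.card_eq_zero.1 (by omega)
  exact isConsistentAt_iff_of_adj_iff_pair (getVert_ne_getVert_add_two hP hi) fun w => by
    simp [adj_getVert_iff hT hP hi, hoff]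

theorem isConsistentAt_getVert_of_term_eq_three (hT : T.IsAcyclic) (hP : P.IsPath)
    (hi : i + 1 < P.length) (h3 : term (reducedDegreeSequence T P) (i + 1) = 3)
    (hzero : ∀ v ∉ P.support, t v = 0) (hpos : 0 < t (P.getVert (i + 1))) :
    IsConsistentAt T t (P.getVert (i + 1)) ↔
      (t (P.getVert i) < t (P.getVert (i + 1)) ∨
          t (P.getVert (i + 2)) < t (P.getVert (i + 1))) ∧
        t (P.getVert (i + 1)) ≤ t (P.getVert i) + 1 ∧
        t (P.getVert (i + 1)) ≤ t (P.getVert (i + 2)) + 1 := by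
  have hcard := card_offNeighbors_add_two hT hP hi
  rw [term_reducedDegreeSequence hi.le] at h3
  obtain ⟨z, hz⟩ : ∃ z, offNeighbors P (P.getVert (i + 1)) = {z} :=
    Finset.card_eq_one.1 (by omega)
  have hzP : z ∉ P.support :=
    (mem_offNeighbors.1 (hz ▸ Finset.mem_singleton_self z)).2
  have hne : ∀ j, P.getVert j ≠ z := fun j h => hzP (h ▸ P.getVert_mem_support j)
  exact isConsistentAt_iff_of_adj_iff_triple (hne _) (hne _)
    (fun w => by simp [adj_getVert_iff hT hP hi, hz]) (hzero z hzP) hpos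

theorem isConsistentAt_getVert_of_term_eq_four (hT : T.IsAcyclic) (hP : P.IsPath)
    (hi : i + 1 < P.length) (h4 : term (reducedDegreeSequence T P) (i + 1) = 4)
    (hzero : ∀ v ∉ P.support, t v = 0) (hpos : 0 < t (P.getVert (i + 1))) :
    IsConsistentAt T t (P.getVert (i + 1)) ↔ t (P.getVert (i + 1)) ≤ 1 := by
  have hcard := card_offNeighbors_add_two hT hP hi
  rw [term_reducedDegreeSequence hi.le] at h4
  obtain ⟨x, hx, y, hy, hxy⟩ :=
    Finset.one_lt_card.1 (show 1 < (offNeighbors P (P.getVert (i + 1))).card by omega)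
  rw [mem_offNeighbors] at hx hy
  exact isConsistentAt_iff_le_one hxy hx.1 hy.1 (hzero x hx.2) (hzero y hy.2) hpos

namespace IsLeafDominatingPath

theorem isReducedDegreeSequence (hP : IsLeafDominatingPath T P) (hT : T.IsAcyclic) :
    IsReducedDegreeSequence (reducedDegreeSequence T P) := by
  obtain ⟨hpath, -, ha, hb, -⟩ := hP
  constructor
  · rw [term_reducedDegreeSequence (Nat.zero_le _), Walk.getVert_zero, ha]
    rfl
  · rw [length_reducedDegreeSequence, Nat.add_sub_cancel, term_reducedDegreeSequence le_rfl,
      Walk.getVert_length, hb]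
    rfl
  · intro i h0 hi
    rw [length_reducedDegreeSequence, Nat.add_lt_add_iff_right] at hi
    obtain ⟨i, rfl⟩ := Nat.exists_eq_add_one_of_ne_zero h0.ne'
    rw [term_reducedDegreeSequence hi.le, ← card_offNeighbors_add_two hT hpath hi]
    omega

theorem interior_of_one_lt_term (hP : IsLeafDominatingPath T P) (hT : T.IsAcyclic)
    (h : 1 < term (reducedDegreeSequence T P) i) : 0 < i ∧ i < P.length := by
  have hlen := length_reducedDegreeSequence P
  have hi := le_length_of_term_ne_zero (P := P) (i := i) (by omega)
  have := (hP.isReducedDegreeSequence hT).interior_of_ne_one (by omega) h.ne'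
  omega

theorem isTimeSequence (hP : IsLeafDominatingPath T P) (hT : T.IsAcyclic)
    (ht : IsTimeFunction T t) : IsTimeSequence (reducedDegreeSequence T P) (t ∘ P.getVert) := by
  have hzero : ∀ v ∉ P.support, t v = 0 := fun v hv =>
    ht.eq_zero_of_subsingleton_neighborSet <|
      subsingleton_neighborSet_of_notMem_support hT hP.2.2.2.2 hv
  have hinterior {i : ℕ} : 1 < term (reducedDegreeSequence T P) i → 0 < i ∧ i < P.length :=
    hP.interior_of_one_lt_term hT
  refine ⟨fun i h1 => ?_, fun i h2 hpos => ?_, fun i h3 hpos => ?_, fun i h4 => ?_⟩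
  · refine ht.eq_zero_of_subsingleton_neighborSet <|
      subsingleton_neighborSet_iff_degree_le_one.2 ?_
    rw [term_reducedDegreeSequence (le_length_of_term_ne_zero (by omega))] at h1
    omega
  · exact (isConsistentAt_getVert_of_term_eq_two hT hP.1 (hinterior (by omega)).2 h2).1 (ht _ hpos)
  · exact (isConsistentAt_getVert_of_term_eq_three hT hP.1 (hinterior (by omega)).2 h3 hzero
      hpos).1 (ht _ hpos)
  · rcases Nat.eq_zero_or_pos (t (P.getVert i)) with h0 | hpos
    · exact h0.trans_le zero_le_one
    obtain ⟨h0, hi⟩ := hinterior (i := i) (by omega)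
    obtain ⟨i, rfl⟩ := Nat.exists_eq_add_one_of_ne_zero h0.ne'
    exact (isConsistentAt_getVert_of_term_eq_four hT hP.1 hi h4 hzero hpos).1 (ht _ hpos)

theorem isTimeFunction (hP : IsLeafDominatingPath T P) (hT : T.IsAcyclic)
    (hτ : IsTimeSequence (reducedDegreeSequence T P) τ) (hzero : ∀ v ∉ P.support, t v = 0)
    (heq : ∀ i ≤ P.length, t (P.getVert i) = τ i) : IsTimeFunction T t := by
  intro v hpos
  have hv : v ∈ P.support := by_contra fun hv => hpos.ne' (hzero v hv)
  obtain ⟨i, rfl, hi⟩ := Walk.mem_support_iff_exists_getVert.1 hv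
  have hs := hP.isReducedDegreeSequence hT
  have hlen := length_reducedDegreeSequence P
  have h1 : term (reducedDegreeSequence T P) i ≠ 1 := fun h1 =>
    hpos.ne' ((heq i hi).trans (hτ.one i h1))
  obtain ⟨h0, hl⟩ := hs.interior_of_ne_one (by omega) h1
  obtain ⟨i, rfl⟩ := Nat.exists_eq_add_one_of_ne_zero h0.ne'
  have hi : i + 1 < P.length := by omega
  have hpos' : 0 < τ (i + 1) := heq (i + 1) hi.le ▸ hpos
  rcases hs.inner _ h0 hl with h2 | h3 | h4
  · rw [isConsistentAt_getVert_of_term_eq_two hT hP.1 hi h2, heq i (by omega), heq _ hi.le,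
      heq _ hi]
    exact hτ.two i h2 hpos'
  · rw [isConsistentAt_getVert_of_term_eq_three hT hP.1 hi h3 hzero hpos, heq i (by omega),
      heq _ hi.le, heq _ hi]
    exact hτ.three i h3 hpos'
  · rw [isConsistentAt_getVert_of_term_eq_four hT hP.1 hi h4 hzero hpos, heq _ hi.le]
    exact hτ.four _ h4

theorem percolationTime_eq (hP : IsLeafDominatingPath T P) (hT : T.IsAcyclic) :
    percolationTime T = maxValue (reducedDegreeSequence T P) := by
  have hs := hP.isReducedDegreeSequence hT
  have hlen := length_reducedDegreeSequence P
  refine le_antisymm (percolationTime_le fun t ht v => ?_) (Finset.sup_le fun i hi => ?_)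
  · by_cases hv : v ∈ P.support
    · obtain ⟨i, rfl, hi⟩ := Walk.mem_support_iff_exists_getVert.1 hv
      have hi : i < (reducedDegreeSequence T P).length := by omega
      calc t (P.getVert i) ≤ value (reducedDegreeSequence T P) i :=
            (hP.isTimeSequence hT ht).le_value hs hi
        _ ≤ maxValue (reducedDegreeSequence T P) := Finset.le_sup (Finset.mem_range.2 hi)
    · exact (ht.eq_zero_of_subsingleton_neighborSet <|
        subsingleton_neighborSet_of_notMem_support hT hP.2.2.2.2 hv).trans_le (Nat.zero_le _)
  · rw [Finset.mem_range] at hi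
    obtain ⟨τ, hτ, hτi⟩ := hs.exists_eq_value hi
    obtain ⟨t, hzero, heq⟩ := exists_extend_getVert hP.1 τ
    rw [← hτi, ← heq i (by omega)]
    exact (hP.isTimeFunction hT hτ hzero heq).le_percolationTime _

end IsLeafDominatingPath

end DominatingPath

section Existence

open SimpleGraph

theorem pathGraph_mem_support_of_zero_last {n : ℕ} (P : (pathGraph (n + 1)).Walk 0 (Fin.last n))
    (m : Fin (n + 1)) : m ∈ P.support := by
  rcases eq_or_ne m 0 with rfl | hm
  · exact P.start_mem_support
  obtain ⟨d, hd, hfst, hsnd⟩ :=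
    P.exists_boundary_dart {x | x < m} (Fin.pos_iff_ne_zero.2 hm) (Fin.le_last m).not_gt
  have hadj := pathGraph_adj.1 d.adj
  have hm : d.snd = m := by
    simp only [Set.mem_ofPred_eq] at hfst hsnd
    omega
  exact hm ▸ P.dart_snd_mem_support_of_mem_darts hd

variable {V : Type*} {T : SimpleGraph V} {a b : V} {P : T.Walk a b}

theorem subsingleton_neighborSet_of_mem_support (hT : T.IsAcyclic) (hP : P.IsPath)
    (h : ∀ u, T.Adj a u → u ∈ P.support) : (T.neighborSet a).Subsingleton :=
  fun u hu w hw => (hT.eq_snd_of_adj_start hP hu (h u hu)).trans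
    (hT.eq_snd_of_adj_start hP hw (h w hw)).symm

theorem exists_isPath_neighbors_mem_support [Finite V] {S : Set V}
    (hP : P.IsPath) (hS : ∀ v ∈ S, v ∈ P.support) :
    ∃ (c d : V) (Q : T.Walk c d), Q.IsPath ∧ (∀ v ∈ S, v ∈ Q.support) ∧
      (∀ u, T.Adj c u → u ∈ Q.support) ∧ ∀ u, T.Adj d u → u ∈ Q.support := by
  have := Fintype.ofFinite V
  let lengths : Set ℕ :=
    {n | ∃ (c d : V) (Q : T.Walk c d), Q.IsPath ∧ (∀ v ∈ S, v ∈ Q.support) ∧ Q.length = n}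
  have hbdd : BddAbove lengths := ⟨Fintype.card V, by
    rintro _ ⟨_, _, Q, hQ, -, rfl⟩
    exact hQ.length_lt.le⟩
  obtain ⟨c, d, Q, hQ, hSQ, hmax⟩ := Nat.sSup_mem (s := lengths) ⟨_, a, b, P, hP, hS, rfl⟩ hbdd
  have hlength {c' d' : V} (Q' : T.Walk c' d') (hQ' : Q'.IsPath)
      (hSQ' : ∀ v ∈ S, v ∈ Q'.support) : Q'.length ≤ Q.length :=
    hmax ▸ le_csSup hbdd ⟨_, _, Q', hQ', hSQ', rfl⟩
  refine ⟨c, d, Q, hQ, hSQ, fun u hu => by_contra fun hmem => ?_,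
    fun u hu => by_contra fun hmem => ?_⟩
  · have := hlength (Q.cons hu.symm) (hQ.cons hmem) fun v hv => by
      simp [hSQ v hv]
    simp at this
  · have := hlength (Q.concat hu) (hQ.concat hmem hu) fun v hv => by
      simp [Walk.support_concat, hSQ v hv]
    simp at this

variable [Fintype V] [DecidableRel T.Adj]

theorem exists_adj_of_forall_degree_ne_one_mem (hT : T.Connected) {S : Set V}
    (hne : S.Nonempty) (hS : ∀ v, T.degree v ≠ 1 → v ∈ S) {v : V} (hv : v ∉ S) :
    ∃ w ∈ S, T.Adj v w := by
  have hunique {v : V} (hv : v ∉ S) : (T.neighborSet v).Subsingleton :=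
    subsingleton_neighborSet_iff_degree_le_one.2 (not_imp_comm.1 (hS v) hv).le
  obtain ⟨x, hx⟩ := hne
  obtain ⟨P⟩ := hT.preconnected v x
  obtain ⟨w, hw⟩ := (T.degree_pos_iff_exists_adj v).1 (by rw [not_imp_comm.1 (hS v) hv]; omega)
  refine ⟨w, by_contra fun hwS => ?_, hw⟩
  obtain ⟨d, -, hfst, hsnd⟩ := P.exists_boundary_dart {v, w} (Or.inl rfl) (by
    rintro (rfl | rfl) <;> contradiction)
  rcases hfst with hfst | hfst
  · exact hsnd (Or.inr (hunique hv (hfst ▸ d.adj) hw))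
  · exact hsnd (Or.inl (hunique hwS (hfst ▸ d.adj) hw.symm))

namespace IsCaterpillar

theorem exists_isPath_forall_mem_support (hT : IsCaterpillar T) :
    ∃ (a b : V) (P : T.Walk a b), P.IsPath ∧ ∀ v, T.degree v ≠ 1 → v ∈ P.support := by
  obtain ⟨htree, n, ⟨e⟩⟩ := hT
  cases n with
  | zero =>
    obtain ⟨a⟩ := htree.connected.nonempty
    exact ⟨a, a, Walk.nil, Walk.IsPath.nil, fun v hv => (e ⟨v, hv⟩).elim0⟩
  | succ n =>
    obtain ⟨P, hP⟩ := (pathGraph_connected n).exists_isPath 0 (Fin.last n)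
    let f : pathGraph (n + 1) ↪g T := e.symm.toEmbedding.trans (Embedding.induce _)
    refine ⟨_, _, P.map f.toHom, hP.map f.injective, fun v hv => ?_⟩
    rw [Walk.support_map]
    exact List.mem_map.2 ⟨e ⟨v, hv⟩, pathGraph_mem_support_of_zero_last P _,
      congrArg Subtype.val (e.symm_apply_apply ⟨v, hv⟩)⟩

theorem exists_isLeafDominatingPath [Nontrivial V] (hT : IsCaterpillar T) :
    ∃ (a b : V) (P : T.Walk a b), IsLeafDominatingPath T P := by
  obtain ⟨_, _, _, hP, hS⟩ := hT.exists_isPath_forall_mem_support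
  obtain ⟨a, b, P, hP, hS, ha, hb⟩ := exists_isPath_neighbors_mem_support hP hS
  obtain ⟨⟨hconn, hacyc⟩, -⟩ := hT
  have hleaf {v : V} (hv : (T.neighborSet v).Subsingleton) : T.degree v = 1 :=
    (subsingleton_neighborSet_iff_degree_le_one.1 hv).antisymm
      (hconn.preconnected.degree_pos_of_nontrivial v)
  refine ⟨a, b, P, hP, ?_, hleaf (subsingleton_neighborSet_of_mem_support hacyc hP ha),
    hleaf (subsingleton_neighborSet_of_mem_support hacyc hP.reverse (by simpa using hb)),
    fun v hv => exists_adj_of_forall_degree_ne_one_mem hconn ⟨a, P.start_mem_support⟩ hS hv⟩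
  rintro rfl
  obtain ⟨u, hu⟩ := (T.degree_pos_iff_exists_adj a).1
    (hconn.preconnected.degree_pos_of_nontrivial a)
  have hmem := ha u hu
  rw [(Walk.isPath_iff_nil.1 hP).eq_nil, Walk.support_nil, List.mem_singleton] at hmem
  exact hu.ne hmem.symm

end IsCaterpillar

end Existence

theorem mainTheorem3 {V : Type*} [Fintype V] [Nontrivial V] (T : SimpleGraph V)
    [DecidableRel T.Adj] (hT : IsCaterpillar T) :
    (∃ (a b : V) (P : T.Walk a b), IsLeafDominatingPath T P) ∧
      ∀ (a b : V) (P : T.Walk a b), IsLeafDominatingPath T P →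
        percolationTime T = PercolationSequence.maxValue (reducedDegreeSequence T P) :=
  ⟨hT.exists_isLeafDominatingPath, fun _ _ _ hP => hP.percolationTime_eq hT.1.isAcyclic⟩
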